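/- Let $n,m\in\mathbb N$, $\Delta>0$, and let $\mathcal C=\mathcal C([-\Delta,0],\mathbb R^n)$ carry the norm $\|\phi\|=\sup_{\theta\in[-\Delta,0]}|\phi(\theta)|$, where $|\cdot|$ is the Euclidean norm. For a function $x$ let $x_t(\theta)=x(t+\theta)$, $\theta\in[-\Delta,0]$. Let $f:\mathcal C\to\mathbb R^n$ and $g:\mathcal C\to\mathbb R^{n\times m}$ be locally Lipschitz with $f(0)=0$, let $U\subseteq\mathbb R^m$, and consider the delay system $\dot x(t)=f(x_t)+g(x_t)u$. A function $\alpha:[0,\infty)\to[0,\infty)$ is of class $\mathcal K$ if it is continuous, strictly increasing and $\alpha(0)=0$, and of class $\mathcal K_\infty$ if moreover it is unbounded. A function $\beta:[0,\infty)^2\to[0,\infty)$ is of class $\mathcal{KL}$ if $\beta(\cdot,t)\in\mathcal K$ for every $t\ge 0$ and, for every $s\ge0$, $\beta(s,\cdot)$ is nonincreasing with $\beta(s,t)\to0$ as $t\to\infty$. For a $C^1$ function $V:\mathbb R^n\to[0,\infty)$ and $\phi\in\mathcal C$ write $L_fV(\phi)=\frac{\partial V}{\partial x}(\phi(0))f(\phi)$,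 $L_gV(\phi)=\frac{\partial V}{\partial x}(\phi(0))g(\phi)$ and $\|V(\phi)\|=\sup_{\theta\in[-\Delta,0]}|V(\phi(\theta))|$. Suppose that $V$ is a control Lyapunov–Razumikhin function of the second type (CLRF-II) for the system: there are $\alpha_1,\alpha_2\in\mathcal K_\infty$ with $\alpha_1(|x|)\le V(x)\le\alpha_2(|x|)$ for all $x\in\mathbb R^n$, and $\gamma,\eta\in\mathcal K$ with $\gamma-\eta\in\mathcal K$ such that, for every nonzero $\phi\in\mathcal C$, $$\inf_{u\in U}\{L_fV(\phi)+L_gV(\phi)u\}<-\gamma(V(\phi(0)))+\eta(\|V(\phi)\|).$$ Suppose also that the Razumikhin-type small control property holds: for every $\varepsilon>0$ there is $\delta>0$ such that for every nonzero $\phi\in\mathcal C$ with $|\phi(\theta)|<\delta$ for all $\theta\in[-\Delta,0]$ there is $u\in\mathbb R^m$ with $|u|<\varepsilon$ and $$L_fV(\phi)+L_gV(\phi)u<-\gamma(V(\phi(0)))+\eta(\|V(\phi)\|).$$ Let $\lambda>0$, $a(\phi)=L_fV(\phi)+\gamma(V(\phi(0)))-\eta(\|V(\phi)\|)$, and define the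 feedback $k:\mathcal C\to\mathbb R^m$ (which is not required to take its values in $U$) by $k(0)=0$ and $k(\phi)=\kappa(\lambda,a(\phi),(L_gV(\phi))^\top)$ for $\phi\ne0$, where $$\kappa(\lambda,p,q)=\begin{cases}\dfrac{p+\sqrt{p^2+\lambda|q|^4}}{-|q|^2}\,q,&q\neq0,\\[1ex]0,&q=0.\end{cases}$$ Let $F(\phi)=f(\phi)+g(\phi)k(\phi)$. By a solution on $[-\Delta,T)$, $0<T\le\infty$, with initial history $\xi\in\mathcal C$ we mean a continuous $x:[-\Delta,T)\to\mathbb R^n$ with $x=\xi$ on $[-\Delta,0]$ and $\dot x(t)=F(x_t)$ for $0<t<T$. Then: 1. $k$ is continuous on $\mathcal C$. 2. The closed loop is globally asymptotically stable: there is $\beta\in\mathcal{KL}$ such that for every $\xi\in\mathcal C$ and every solution $x$ on some $[-\Delta,T)$, $0<T\le\infty$, with initial history $\xi$, one has $|x(t)|\le\beta(\|\xi\|,t)$ for all $0\le t<T$. 3. For every $\xi\in\mathcal C$ there is a solution with initial history $\xi$ on $[-\Delta,T)$ for some $T>0$; and if $F$ maps bounded sets to bounded sets, then every solution on some $[-\Delta,T)$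 extends to a solution on $[-\Delta,\infty)$. -/

import Mathlib

open Set Filter Topology
open scoped NNReal

noncomputable section

namespace DelaySystem

/-- Euclidean space of dimension `n`. -/
abbrev Euc (n : ℕ) : Type := EuclideanSpace ℝ (Fin n)

/-- The space of continuous functions from `[-Δ, 0]` to Euclidean `n`-space; its Mathlib norm is
the supremum norm. -/
abbrev History (Δ : ℝ≥0) (n : ℕ) : Type := C(Set.Icc (-(Δ : ℝ)) 0, Euc n)

/-- The present value `φ(0)` of a history `φ`. -/
def History.now {Δ : ℝ≥0} {n : ℕ} (φ : History Δ n) : Euc n :=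
  φ ⟨0, by simp⟩

/-- Class `K` functions on `[0, ∞)`: continuous, strictly increasing, zero at zero.
Only the values on `[0, ∞)` matter. -/
structure IsClassK (α : ℝ → ℝ) : Prop where
  continuousOn : ContinuousOn α (Ici 0)
  strictMonoOn : StrictMonoOn α (Ici 0)
  map_zero : α 0 = 0

/-- Class `K_∞` functions: unbounded class `K` functions. -/
structure IsClassKInfty (α : ℝ → ℝ) : Prop where
  isClassK : IsClassK α
  unbounded : ∀ M : ℝ, ∃ s : ℝ, 0 ≤ s ∧ M ≤ α s

/-- Class `KL` functions: of class `K` in the first variable, nonincreasing and tending to zero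
in the second one. -/
structure IsClassKL (β : ℝ → ℝ → ℝ) : Prop where
  isClassK : ∀ t : ℝ, 0 ≤ t → IsClassK (fun s => β s t)
  antitoneOn : ∀ s : ℝ, 0 ≤ s → AntitoneOn (β s) (Ici 0)
  tendsto_zero : ∀ s : ℝ, 0 ≤ s → Tendsto (β s) atTop (𝓝 0)

variable {Δ : ℝ≥0} {n m : ℕ}

/-- `L_f V(φ) = V'(φ(0)) f(φ)`. -/
def lieF (V : Euc n → ℝ) (f : History Δ n → Euc n) (φ : History Δ n) : ℝ :=
  fderiv ℝ V φ.now (f φ)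

/-- The row vector `L_g V(φ) = V'(φ(0)) g(φ)`, as a linear form on the space of controls. -/
def lieG (V : Euc n → ℝ) (g : History Δ n → (Euc m →L[ℝ] Euc n)) (φ : History Δ n) :
    Euc m →L[ℝ] ℝ :=
  (fderiv ℝ V φ.now).comp (g φ)

/-- The column vector `(L_g V(φ))ᵀ`: the vector `q` with `L_g V(φ) u = ⟪q, u⟫` for all `u`. -/
def lieGT (V : Euc n → ℝ) (g : History Δ n → (Euc m →L[ℝ] Euc n)) (φ : History Δ n) : Euc m :=
  (InnerProductSpace.toDual ℝ (Euc m)).symm (lieG V g φ)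

/-- `‖V(φ)‖`, the supremum of `|V(φ(θ))|` over `θ ∈ [-Δ, 0]`. -/
def supV (V : Euc n → ℝ) (φ : History Δ n) : ℝ :=
  ⨆ θ : Set.Icc (-(Δ : ℝ)) 0, |V (φ θ)|

/-- `V` is a control Lyapunov-Razumikhin function of the second type (CLRF-II), with the class `K`
functions `γ` and `η`, for the delay system `ẋ(t) = f(x_t) + g(x_t) u` with controls in `U`.
The infimum is taken in the extended reals. -/
structure IsCLRFII (U : Set (Euc m)) (f : History Δ n → Euc n)
    (g : History Δ n → (Euc m →L[ℝ] Euc n)) (V : Euc n → ℝ) (γ η : ℝ → ℝ) : Prop where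
  contDiff : ContDiff ℝ 1 V
  nonneg : ∀ x, 0 ≤ V x
  sandwich : ∃ α₁ α₂ : ℝ → ℝ, IsClassKInfty α₁ ∧ IsClassKInfty α₂ ∧
    ∀ x, α₁ ‖x‖ ≤ V x ∧ V x ≤ α₂ ‖x‖
  classK_γ : IsClassK γ
  classK_η : IsClassK η
  classK_sub : IsClassK (fun s => γ s - η s)
  decrease : ∀ φ : History Δ n, φ ≠ 0 →
    (⨅ u ∈ U, ((lieF V f φ + lieG V g φ u : ℝ) : EReal)) <
      ((-γ (V φ.now) + η (supV V φ) : ℝ) : EReal)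

/-- The Razumikhin-type small control property. -/
def RSCP (f : History Δ n → Euc n) (g : History Δ n → (Euc m →L[ℝ] Euc n))
    (V : Euc n → ℝ) (γ η : ℝ → ℝ) : Prop :=
  ∀ ε : ℝ, 0 < ε → ∃ δ : ℝ, 0 < δ ∧
    ∀ φ : History Δ n, φ ≠ 0 → (∀ θ, φ θ ∈ Metric.ball (0 : Euc n) δ) →
      ∃ u ∈ Metric.ball (0 : Euc m) ε,
        lieF V f φ + lieG V g φ u < -γ (V φ.now) + η (supV V φ)

open Classical in
/-- The Sontag-type function `κ(lam, p, q)`. -/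
def kappa (lam p : ℝ) (q : Euc m) : Euc m :=
  if q = 0 then 0
  else ((p + Real.sqrt (p ^ 2 + lam * ‖q‖ ^ 4)) / (-‖q‖ ^ 2)) • q

/-- `a(φ) = L_f V(φ) + γ(V(φ(0))) - η(‖V(φ)‖)`. -/
def drift (f : History Δ n → Euc n) (V : Euc n → ℝ) (γ η : ℝ → ℝ) (φ : History Δ n) : ℝ :=
  lieF V f φ + γ (V φ.now) - η (supV V φ)

open Classical in
/-- The Sontag-type feedback law. -/
def sontagFeedback (f : History Δ n → Euc n) (g : History Δ n → (Euc m →L[ℝ] Euc n))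
    (V : Euc n → ℝ) (γ η : ℝ → ℝ) (lam : ℝ) (φ : History Δ n) : Euc m :=
  if φ = 0 then 0 else kappa lam (drift f V γ η φ) (lieGT V g φ)

/-- The right-hand side `f(φ) + g(φ) u(φ)` of the closed loop under the feedback `u`. -/
def closedLoop (f : History Δ n → Euc n) (g : History Δ n → (Euc m →L[ℝ] Euc n))
    (u : History Δ n → Euc m) (φ : History Δ n) : Euc n :=
  f φ + g φ (u φ)

/-- `x` is a solution on `[-Δ, T)`, with `0 < T ≤ ∞`, of `ẋ(t) = F(x_t)` for `0 < t < T` with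
`x = ξ` on `[-Δ, 0]`. The values of `x` off `[-Δ, T)` are irrelevant. The element `φ` is `x_t`. -/
structure IsSolution (F : History Δ n → Euc n) (ξ : History Δ n) (T : EReal) (x : ℝ → Euc n) :
    Prop where
  pos : 0 < T
  continuousOn : ContinuousOn x {t : ℝ | -(Δ : ℝ) ≤ t ∧ (t : EReal) < T}
  initial : ∀ θ : Set.Icc (-(Δ : ℝ)) 0, x θ = ξ θ
  equation : ∀ t : ℝ, 0 < t → (t : EReal) < T →
    ∃ φ : History Δ n, (∀ θ : Set.Icc (-(Δ : ℝ)) 0, φ θ = x (t + θ)) ∧ HasDerivAt x (F φ) t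

/-- Global asymptotic stability of `ẋ(t) = F(x_t)`: a `KL` estimate, the same for all initial
data, along every solution for as long as the solution exists. -/
def IsGAS (F : History Δ n → Euc n) : Prop :=
  ∃ β : ℝ → ℝ → ℝ, IsClassKL β ∧
    ∀ (ξ : History Δ n) (T : EReal) (x : ℝ → Euc n), IsSolution F ξ T x →
      ∀ t : ℝ, 0 ≤ t → (t : EReal) < T → ‖x t‖ ≤ β ‖ξ‖ t

/-- Every initial history is the start of a solution on some `[-Δ, T)` with `T > 0`. -/
def HasLocalSolutions (F : History Δ n → Euc n) : Prop :=
  ∀ ξ : History Δ n, ∃ (T : EReal) (x : ℝ → Euc n), IsSolution F ξ T x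

/-- Every solution on some `[-Δ, T)` extends to a solution on `[-Δ, ∞)`. -/
def IsForwardComplete (F : History Δ n → Euc n) : Prop :=
  ∀ (ξ : History Δ n) (T : EReal) (x : ℝ → Euc n), IsSolution F ξ T x →
    ∃ y : ℝ → Euc n, IsSolution F ξ ⊤ y ∧
      ∀ t : ℝ, -(Δ : ℝ) ≤ t → (t : EReal) < T → y t = x t

/-- `F` maps bounded sets to bounded sets. -/
def MapsBoundedToBounded (F : History Δ n → Euc n) : Prop :=
  ∀ s : Set (History Δ n), Bornology.IsBounded s → Bornology.IsBounded (F '' s)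

end DelaySystem

end

/-!
Along the closed loop the feedback gives, for every history `φ`,
`V'(φ(0)) F(φ) ≤ -γ(V(φ(0))) + η(‖V(φ)‖)` (`IsCLRFII.fderiv_closedLoop_le`): where `L_g V ≠ 0` the
formula `κ` cancels `a(φ)` and subtracts a square root, and where `L_g V = 0` the decrease condition
forces `a(φ) < 0`. The feedback is continuous away from `0` because `κ(λ, p, q)` is continuous
wherever `q ≠ 0` or `p < 0`; at `0` the small control property and `L_g V(0) = 0` bound it
(`IsCLRFII.continuous_sontagFeedback`). The latter holds because `V` has a minimum at `0`.

Hence `w(t) = V(x(t))` satisfies a scalar Razumikhin inequality `RazumikhinDecay`. As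
`γ - η` is positive, an upper bound of `w` over one history persists, and uniform continuity of
`γ` on compact intervals lowers the bound by a fixed amount in a fixed time until it is below any
given level, uniformly over initial values in a bounded set (`exists_attraction_time`). Stability
and attraction of this uniform kind are turned into a class `KL` bound by averaging the least
monotone upper bound over `[R, 2R]` (`exists_classKL_bound`).

The closed-loop right-hand side is only continuous, so existence rests on a Peano theorem for delay
equations (`exists_integral_solution`): for bounded right-hand sides, the equations with an
additional small delay `h` can be solved stepwise, and by the Arzelà-Ascoli theorem and dominated
convergence a subsequence converges to a solution as `h → 0`. Local existence follows by truncating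
the right-hand side. For the continuation of a solution from `[-Δ, b)`, the stability estimate
confines every solution to a fixed ball, so the solution extends continuously to `b`, and beyond `b`
it can be continued with a right-hand side truncated above its values on that ball, where the
truncation never becomes active (`isForwardComplete_of_isGAS`).
-/

namespace DelaySystem

/-! ### Class `KL` bounds from uniform estimates -/

/-- Averaging a monotone function over `[R, 2R]`, in the scale-invariant form
`∫₁² ψ(R u) du`, which also makes sense at `R = 0`. -/
noncomputable def dyadicAverage (ψ : ℝ → ℝ) (R : ℝ) : ℝ := ∫ u in (1 : ℝ)..2, ψ (R * u)

section DyadicAverage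

variable {ψ : ℝ → ℝ}

lemma intervalIntegrable_comp_mul (hψ : Monotone ψ) {R : ℝ} (hR : 0 ≤ R) (a b : ℝ) :
    IntervalIntegrable (fun u => ψ (R * u)) MeasureTheory.volume a b :=
  (hψ.comp (monotone_id.const_mul hR)).intervalIntegrable

lemma le_dyadicAverage (hψ : Monotone ψ) {R : ℝ} (hR : 0 ≤ R) : ψ R ≤ dyadicAverage ψ R := by
  have h := intervalIntegral.integral_mono_on (a := 1) (b := 2) (f := fun _ => ψ R)
    (g := fun u => ψ (R * u)) (by norm_num) (by simp) (intervalIntegrable_comp_mul hψ hR _ _)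
    (fun u hu => hψ (by nlinarith [hu.1]))
  rw [intervalIntegral.integral_const] at h
  norm_num at h
  exact h

lemma dyadicAverage_le (hψ : Monotone ψ) {R : ℝ} (hR : 0 ≤ R) :
    dyadicAverage ψ R ≤ ψ (2 * R) := by
  have h := intervalIntegral.integral_mono_on (a := 1) (b := 2) (g := fun _ => ψ (2 * R))
    (f := fun u => ψ (R * u)) (by norm_num) (intervalIntegrable_comp_mul hψ hR _ _) (by simp)
    (fun u hu => hψ (by nlinarith [hu.2]))
  rw [intervalIntegral.integral_const] at h
  norm_num at h
  exact h

lemma dyadicAverage_mono_fun {ψ' : ℝ → ℝ} (hψ : Monotone ψ) (hψ' : Monotone ψ')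
    (h : ∀ r, ψ r ≤ ψ' r) {R : ℝ} (hR : 0 ≤ R) : dyadicAverage ψ R ≤ dyadicAverage ψ' R :=
  intervalIntegral.integral_mono_on (by norm_num) (intervalIntegrable_comp_mul hψ hR _ _)
    (intervalIntegrable_comp_mul hψ' hR _ _) (fun _ _ => h _)

lemma monotoneOn_dyadicAverage (hψ : Monotone ψ) : MonotoneOn (dyadicAverage ψ) (Ici 0) := by
  intro R hR R' hR' hRR'
  exact intervalIntegral.integral_mono_on (by norm_num) (intervalIntegrable_comp_mul hψ hR _ _)
    (intervalIntegrable_comp_mul hψ hR' _ _)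
    (fun u hu => hψ (mul_le_mul_of_nonneg_right hRR' (by linarith [hu.1])))

lemma continuousOn_dyadicAverage (hψ : Monotone ψ) (h0 : ∀ r, 0 ≤ ψ r)
    (hlim : ∀ ε > 0, ∃ δ > 0, ψ δ ≤ ε) : ContinuousOn (dyadicAverage ψ) (Ici 0) := by
  have hψ0 : ψ 0 = 0 := by
    refine le_antisymm (le_of_forall_pos_le_add fun ε hε => ?_) (h0 0)
    obtain ⟨δ, hδ, h⟩ := hlim ε hε
    linarith [hψ hδ.le]
  intro R hR
  rcases (show (0 : ℝ) ≤ R from hR).eq_or_lt with rfl | hR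
  · have hA0 : dyadicAverage ψ 0 = 0 := by simp [dyadicAverage, hψ0]
    rw [Metric.continuousWithinAt_iff]
    intro ε hε
    obtain ⟨δ, hδ, h⟩ := hlim (ε / 2) (by positivity)
    refine ⟨δ / 2, by positivity, fun {r} hr hrδ => ?_⟩
    have hr : (0 : ℝ) ≤ r := hr
    rw [Real.dist_eq, sub_zero, abs_of_nonneg hr] at hrδ
    have h1 := dyadicAverage_le hψ hr
    have h2 : ψ (2 * r) ≤ ψ δ := hψ (by linarith)
    have h3 := le_dyadicAverage hψ hr
    rw [hA0, Real.dist_eq, sub_zero, abs_of_nonneg ((h0 r).trans h3)]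
    linarith
  · -- Away from `0` the substitution `ρ = R u` exhibits a difference of primitives of `ψ`.
    have hint : ∀ a b, IntervalIntegrable ψ MeasureTheory.volume a b :=
      fun a b => hψ.intervalIntegrable
    have hprim : Continuous fun x => ∫ ρ in (0 : ℝ)..x, ψ ρ :=
      intervalIntegral.continuous_primitive hint 0
    have hform : ∀ r : ℝ, 0 < r → dyadicAverage ψ r =
        r⁻¹ * ((∫ ρ in (0 : ℝ)..(r * 2), ψ ρ) - ∫ ρ in (0 : ℝ)..(r * 1), ψ ρ) := by
      intro r hr
      rw [dyadicAverage, intervalIntegral.integral_comp_mul_left _ hr.ne', smul_eq_mul,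
        intervalIntegral.integral_interval_sub_left (hint _ _) (hint _ _)]
    have hc : ContinuousAt (fun r : ℝ =>
        r⁻¹ * ((∫ ρ in (0 : ℝ)..(r * 2), ψ ρ) - ∫ ρ in (0 : ℝ)..(r * 1), ψ ρ)) R := by
      refine (continuousAt_inv₀ hR.ne').mul (Continuous.continuousAt ?_)
      exact (hprim.comp (continuous_id.mul continuous_const)).sub
        (hprim.comp (continuous_id.mul continuous_const))
    refine (hc.congr ?_).continuousWithinAt
    filter_upwards [lt_mem_nhds hR] with r hr using (hform r hr).symm

end DyadicAverage

/-- The smallest upper bound, monotone in `R` and antitone in `t`, of the nonnegative values `y`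
that a relation `S r s y` allows; `0` is inserted to make the set nonempty. -/
noncomputable def upperEnvelope (S : ℝ → ℝ → ℝ → Prop) (R t : ℝ) : ℝ :=
  sSup (insert 0 {y | ∃ r s, S r s y ∧ r ≤ R ∧ t ≤ s})

/-- A quantity `y` at time `t` with initial size `r`, as related by `S r t y`, has a class `KL`
bound as soon as it is bounded, small for small `r`, and small for large `t`, each time uniformly
over bounded `r`. -/
theorem exists_classKL_bound (S : ℝ → ℝ → ℝ → Prop) (hS : ∀ r t y, S r t y → 0 ≤ r)
    (hbdd : ∀ R, ∃ M, ∀ r t y, S r t y → r ≤ R → y ≤ M)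
    (hstab : ∀ ε > 0, ∃ δ > 0, ∀ r t y, S r t y → r ≤ δ → y ≤ ε)
    (hattr : ∀ R, ∀ ε > 0, ∃ T, ∀ r t y, S r t y → r ≤ R → T ≤ t → y ≤ ε) :
    ∃ β, IsClassKL β ∧ ∀ r t y, S r t y → y ≤ β r t := by
  have hBA : ∀ R t, BddAbove (insert 0 {y | ∃ r s, S r s y ∧ r ≤ R ∧ t ≤ s}) := by
    intro R t
    obtain ⟨M, hM⟩ := hbdd R
    refine ⟨max 0 M, ?_⟩
    rintro y (rfl | ⟨r, s, h, hr, -⟩)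
    · exact le_max_left _ _
    · exact (hM r s y h hr).trans (le_max_right _ _)
  have hle : ∀ R t ε, 0 ≤ ε → (∀ r s y, S r s y → r ≤ R → t ≤ s → y ≤ ε) →
      upperEnvelope S R t ≤ ε := by
    intro R t ε hε h
    refine csSup_le (insert_nonempty _ _) ?_
    rintro y (rfl | ⟨r, s, hS, hr, hs⟩)
    · exact hε
    · exact h r s y hS hr hs
  have hnn : ∀ R t, 0 ≤ upperEnvelope S R t := fun R t => le_csSup (hBA R t) (mem_insert _ _)
  have hmono : ∀ t, Monotone fun R => upperEnvelope S R t := by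
    intro t R R' hRR'
    refine csSup_le_csSup (hBA R' t) (insert_nonempty _ _) (insert_subset_insert ?_)
    rintro y ⟨r, s, h, hr, hs⟩
    exact ⟨r, s, h, hr.trans hRR', hs⟩
  have hanti : ∀ R, Antitone fun t => upperEnvelope S R t := by
    intro R t t' htt'
    refine csSup_le_csSup (hBA R t) (insert_nonempty _ _) (insert_subset_insert ?_)
    rintro y ⟨r, s, h, hr, hs⟩
    exact ⟨r, s, h, hr, htt'.trans hs⟩
  have hlim : ∀ t, ∀ ε > 0, ∃ δ > 0, upperEnvelope S δ t ≤ ε := by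
    intro t ε hε
    obtain ⟨δ, hδ, h⟩ := hstab ε hε
    exact ⟨δ, hδ, hle δ t ε hε.le fun r s y hy hr _ => h r s y hy hr⟩
  -- The linear term makes the bound strictly increasing in the first variable.
  refine ⟨fun R t => dyadicAverage (fun R => upperEnvelope S R t) R + R * Real.exp (-t),
    ⟨fun t _ => ⟨?_, ?_, ?_⟩, fun R hR => ?_, fun R hR => ?_⟩, fun r t y hy => ?_⟩
  · exact (continuousOn_dyadicAverage (hmono t) (fun R => hnn R t) (hlim t)).add (by fun_prop)
  · intro R hR R' hR' hRR'
    exact add_lt_add_of_le_of_lt (monotoneOn_dyadicAverage (hmono t) hR hR' hRR'.le)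
      (mul_lt_mul_of_pos_right hRR' (Real.exp_pos _))
  · have h0 : upperEnvelope S 0 t = 0 := by
      refine le_antisymm (le_of_forall_pos_le_add fun ε hε => ?_) (hnn _ _)
      obtain ⟨δ, hδ, h⟩ := hlim t ε hε
      linarith [hmono t hδ.le]
    simp [dyadicAverage, h0]
  · intro t _ t' _ htt'
    refine add_le_add (dyadicAverage_mono_fun (hmono _) (hmono _) (fun R => hanti R htt') hR) ?_
    exact mul_le_mul_of_nonneg_left (Real.exp_le_exp.2 (neg_le_neg htt')) hR
  · have h1 : Tendsto (fun t => R * Real.exp (-t)) atTop (𝓝 0) := by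
      simpa using Real.tendsto_exp_neg_atTop_nhds_zero.const_mul R
    have h2 : Tendsto (fun t => upperEnvelope S (2 * R) t) atTop (𝓝 0) := by
      rw [Metric.tendsto_atTop]
      intro ε hε
      obtain ⟨T, hT⟩ := hattr (2 * R) (ε / 2) (by positivity)
      refine ⟨T, fun t ht => ?_⟩
      rw [Real.dist_eq, sub_zero, abs_of_nonneg (hnn _ _)]
      have := hle (2 * R) t (ε / 2) (by positivity)
        fun r s y hy hr hs => hT r s y hy hr (ht.trans hs)
      linarith
    have h3 : Tendsto (fun t => dyadicAverage (fun R => upperEnvelope S R t) R) atTop (𝓝 0) :=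
      squeeze_zero (fun t => (hnn R t).trans (le_dyadicAverage (hmono t) hR))
        (fun t => dyadicAverage_le (hmono t) hR) h2
    simpa using h3.add h1
  · have hr := hS r t y hy
    have h1 : y ≤ upperEnvelope S r t :=
      le_csSup (hBA r t) (mem_insert_of_mem _ ⟨r, t, hy, le_rfl, le_rfl⟩)
    have h2 := le_dyadicAverage (hmono t) hr
    have h3 : 0 ≤ r * Real.exp (-t) := mul_nonneg hr (Real.exp_pos _).le
    dsimp only at h2 ⊢
    linarith

/-! ### A Razumikhin-type differential inequality -/

lemma IsClassK.pos {α : ℝ → ℝ} (h : IsClassK α) {s : ℝ} (hs : 0 < s) : 0 < α s := by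
  simpa [h.map_zero] using h.strictMonoOn self_mem_Ici hs.le hs

lemma IsClassK.nonneg {α : ℝ → ℝ} (h : IsClassK α) {s : ℝ} (hs : 0 ≤ s) : 0 ≤ α s := by
  simpa [h.map_zero] using h.strictMonoOn.monotoneOn self_mem_Ici hs hs

/-- The scalar inequality `w'(t) ≤ -γ(w(t)) + η(sup_{[t-Δ,t]} w)` on `(0, b]`, for a nonnegative
continuous function `w` on `[-Δ, b]`. Upper bounds `c` of `w` on `[t-Δ, t]` replace the
supremum. -/
structure RazumikhinDecay (γ η : ℝ → ℝ) (Δ b : ℝ) (w : ℝ → ℝ) : Prop where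
  continuousOn : ContinuousOn w (Icc (-Δ) b)
  nonneg : ∀ t, 0 ≤ w t
  decay : ∀ t ∈ Ioc 0 b, ∃ w', HasDerivAt w w' t ∧
    ∀ c, (∀ s ∈ Icc (t - Δ) t, w s ≤ c) → w' ≤ -γ (w t) + η c

namespace RazumikhinDecay

variable {γ η : ℝ → ℝ} {Δ b : ℝ} {w : ℝ → ℝ}

/-- A strict bound on one history persists: at a first time where `w = c`, the function `w` would
have to increase while the differential inequality forces `w' < 0`. -/
lemma lt_of_lt (h : RazumikhinDecay γ η Δ b w) (hsub : IsClassK fun s => γ s - η s) (hΔ : 0 ≤ Δ)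
    {c : ℝ} (hc : ∀ s ∈ Icc (-Δ) 0, w s < c) : ∀ s ∈ Icc (-Δ) b, w s < c := by
  by_contra! hcon
  obtain ⟨s₀, hs₀, hs₀c⟩ := hcon
  have hcpos : 0 < c := (h.nonneg 0).trans_lt (hc 0 ⟨by linarith, le_rfl⟩)
  have hcomp : IsCompact (Icc (-Δ) b ∩ w ⁻¹' Ici c) :=
    isCompact_Icc.of_isClosed_subset
      (h.continuousOn.preimage_isClosed_of_isClosed isClosed_Icc isClosed_Ici) inter_subset_left
  obtain ⟨t, ⟨ht, htc⟩, hmin⟩ := hcomp.exists_isLeast ⟨s₀, hs₀, hs₀c⟩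
  have htc : c ≤ w t := htc
  have ht0 : 0 < t := by
    by_contra! hle
    exact absurd (hc t ⟨ht.1, hle⟩) (not_lt.2 htc)
  have hbefore : ∀ s ∈ Ico (-Δ) t, w s < c := by
    intro s hs
    by_contra! hle
    exact absurd (hmin ⟨⟨hs.1, hs.2.le.trans ht.2⟩, hle⟩) (not_le.2 hs.2)
  obtain ⟨w', hw', hdec⟩ := h.decay t ⟨ht0, ht.2⟩
  have hlim : Tendsto w (𝓝[<] t) (𝓝 (w t)) := hw'.continuousAt.tendsto.mono_left nhdsWithin_le_nhds
  have hev : ∀ᶠ s in 𝓝[<] t, s ∈ Ioo 0 t := Ioo_mem_nhdsLT ht0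
  have hteq : w t = c := by
    refine le_antisymm (le_of_tendsto hlim ?_) htc
    filter_upwards [hev] with s hs using (hbefore s ⟨by linarith [hs.1], hs.2⟩).le
  have hneg : w' < 0 := by
    have h1 := hdec c fun s hs => by
      rcases hs.2.lt_or_eq with hlt | rfl
      · exact (hbefore s ⟨by linarith [hs.1], hlt⟩).le
      · exact hteq.le
    have h2 := hsub.pos hcpos
    rw [hteq] at h1
    linarith
  have hslope : Tendsto (slope w t) (𝓝[<] t) (𝓝 w') :=
    (hasDerivAt_iff_tendsto_slope.1 hw').mono_left (nhdsWithin_mono _ fun s hs => ne_of_lt hs)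
  have : 0 ≤ w' := by
    refine ge_of_tendsto hslope ?_
    filter_upwards [hev] with s hs
    have := hbefore s ⟨by linarith [hs.1], hs.2⟩
    rw [slope_def_field]
    exact div_nonneg_of_nonpos (by linarith) (by linarith [hs.2])
  linarith

lemma le_of_le (h : RazumikhinDecay γ η Δ b w) (hsub : IsClassK fun s => γ s - η s) (hΔ : 0 ≤ Δ)
    {c : ℝ} (hc : ∀ s ∈ Icc (-Δ) 0, w s ≤ c) : ∀ s ∈ Icc (-Δ) b, w s ≤ c := by
  intro s hs
  refine le_of_forall_pos_lt_add fun ε hε => ?_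
  exact h.lt_of_lt hsub hΔ (fun s hs => (hc s hs).trans_lt (by linarith)) s hs

/-- If `w ≤ c` from time `t₀ - Δ` on, and `w' ≤ -μ` wherever `c - δ < w`, then `w ≤ c - δ` from
time `t₀ + δ / μ` on. -/
lemma le_sub_of_le (h : RazumikhinDecay γ η Δ b w) (hΔ : 0 ≤ Δ) {c δ μ t₀ : ℝ}
    (hμ : 0 < μ) (ht₀ : 0 ≤ t₀) (hc : ∀ s ∈ Icc (t₀ - Δ) b, w s ≤ c)
    (hrate : ∀ v, 0 ≤ v → v ≤ c → c - δ < v → -γ v + η c ≤ -μ) :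
    ∀ t ∈ Icc (t₀ + δ / μ) b, t₀ ≤ t → w t ≤ c - δ := by
  intro t ht htt₀
  by_contra! hcon
  have hdrop : ∀ s ∈ Icc t₀ t, (∀ r ∈ Ioc s t, c - δ < w r) → w t ≤ w s - μ * (t - s) := by
    intro s hs hr
    have hder : ∀ r ∈ Ioo s t, ∃ w', HasDerivAt w w' r ∧ w' ≤ -μ := by
      intro r hr'
      obtain ⟨w', hw', hdec⟩ := h.decay r ⟨by linarith [hs.1, hr'.1], by linarith [hr'.2, ht.2]⟩
      refine ⟨w', hw', ?_⟩
      refine (hdec c fun q hq => hc q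
        ⟨by linarith [hq.1, hs.1, hr'.1], by linarith [hq.2, hr'.2, ht.2]⟩).trans ?_
      exact hrate _ (h.nonneg r) (hc r ⟨by linarith [hs.1, hr'.1], by linarith [hr'.2, ht.2]⟩)
        (hr r ⟨hr'.1, hr'.2.le⟩)
    have := (convex_Icc s t).image_sub_le_mul_sub_of_deriv_le
      (h.continuousOn.mono (Icc_subset_Icc (by linarith [hs.1]) ht.2))
      (fun r hr' => by
        rw [interior_Icc] at hr'
        obtain ⟨w', hw', -⟩ := hder r hr'
        exact hw'.differentiableAt.differentiableWithinAt)
      (C := -μ) (fun r hr' => by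
        rw [interior_Icc] at hr'
        obtain ⟨w', hw', hle⟩ := hder r hr'
        rwa [hw'.deriv])
      s ⟨le_rfl, hs.2⟩ t ⟨hs.2, le_rfl⟩ hs.2
    linarith
  by_cases hne : (Icc t₀ t ∩ w ⁻¹' Iic (c - δ)).Nonempty
  · -- The last time at which `w ≤ c - δ`; afterwards `w` decreases.
    have hcomp : IsCompact (Icc t₀ t ∩ w ⁻¹' Iic (c - δ)) :=
      isCompact_Icc.of_isClosed_subset
        ((h.continuousOn.mono (Icc_subset_Icc (by linarith) ht.2)).preimage_isClosed_of_isClosed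
          isClosed_Icc isClosed_Iic) inter_subset_left
    obtain ⟨s, ⟨hs, hsc⟩, hmax⟩ := hcomp.exists_isGreatest hne
    have hsc : w s ≤ c - δ := hsc
    have := hdrop s hs fun r hr => by
      by_contra! hle
      exact absurd (hmax ⟨⟨hs.1.trans hr.1.le, hr.2⟩, hle⟩) (not_le.2 hr.1)
    nlinarith [hs.2]
  · have hall : ∀ r ∈ Icc t₀ t, c - δ < w r := by
      intro r hr
      by_contra! hle
      exact hne ⟨r, hr, hle⟩
    have h1 := hdrop t₀ ⟨le_rfl, htt₀⟩ fun r hr => hall r ⟨hr.1.le, hr.2⟩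
    have h2 := hc t₀ ⟨by linarith, htt₀.trans ht.2⟩
    have h3 : δ ≤ μ * (t - t₀) := by
      have := ht.1
      rw [← div_le_iff₀' hμ]
      linarith
    linarith

end RazumikhinDecay

/-- Uniform attraction: the time to come below the level `ε` from initial values at most `R`
depends on `γ`, `η` and `Δ` only. On `[ε, R]` the gap `γ - η` is at least its value at `ε`, so by
uniform continuity of `γ` the level drops by a fixed `δ > 0` within a fixed time. -/
theorem exists_attraction_time {γ η : ℝ → ℝ} {Δ : ℝ} (hΔ : 0 ≤ Δ) (hγ : IsClassK γ)
    (hsub : IsClassK fun s => γ s - η s) (R : ℝ) {ε : ℝ} (hε : 0 < ε) :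
    ∃ T, ∀ b w, RazumikhinDecay γ η Δ b w → (∀ s ∈ Icc (-Δ) 0, w s ≤ R) →
      ∀ t ∈ Icc T b, w t ≤ ε := by
  set μ : ℝ := (γ ε - η ε) / 2 with hμ_def
  have hμ : 0 < μ := half_pos (hsub.pos hε)
  obtain ⟨δ, hδ, hδγ⟩ := Metric.uniformContinuousOn_iff.1
    (isCompact_Icc.uniformContinuousOn_of_continuous
      (hγ.continuousOn.mono (Icc_subset_Ici_self : Icc 0 (max ε R) ⊆ Ici 0))) μ hμ
  set τ : ℝ := δ / μ + Δ with hτ_def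
  have hτ : 0 < τ := by positivity
  have key : ∀ k : ℕ, ∀ b w, RazumikhinDecay γ η Δ b w → (∀ s ∈ Icc (-Δ) 0, w s ≤ R) →
      ∀ t ∈ Icc (k * τ - Δ) b, w t ≤ max ε (R - k * δ) := by
    intro k b w h hR
    induction k with
    | zero =>
      intro t ht
      simp only [Nat.cast_zero, zero_mul, zero_sub, sub_zero] at ht ⊢
      exact (h.le_of_le hsub hΔ hR t ht).trans (le_max_right _ _)
    | succ k ih =>
      intro t ht
      push_cast at ht ⊢
      set c := max ε (R - k * δ) with hc_def
      have hεc : ε ≤ c := le_max_left _ _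
      have hkδ : (0 : ℝ) ≤ k * δ := by positivity
      have hcR : c ≤ max ε R := max_le_max le_rfl (by linarith)
      have hkτ : (0 : ℝ) ≤ k * τ := by positivity
      have h1 := h.le_sub_of_le (δ := δ) (c := c) hΔ hμ hkτ ih
        (fun v hv0 hvc hv => by
          have h2 := hδγ c ⟨by linarith, hcR⟩ v ⟨hv0, hvc.trans hcR⟩
            (by rw [Real.dist_eq, abs_lt]; constructor <;> linarith)
          rw [Real.dist_eq, abs_lt] at h2
          have h3 := hsub.strictMonoOn.monotoneOn hε.le (hε.le.trans hεc) hεc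
          linarith [h2.2]) t ⟨by linarith [ht.1], ht.2⟩
          (by have := ht.1; have : 0 < δ / μ := by positivity
              linarith)
      refine h1.trans ?_
      rcases max_cases ε (R - k * δ) with ⟨he, -⟩ | ⟨he, -⟩
      · exact le_max_of_le_left (by rw [hc_def, he]; linarith)
      · exact le_max_of_le_right (by rw [hc_def, he]; linarith)
  obtain ⟨k, hk⟩ := exists_nat_ge (R / δ)
  refine ⟨k * τ, fun b w h hR t ht => ?_⟩
  have h1 := key k b w h hR t ⟨by linarith [ht.1], ht.2⟩
  rw [div_le_iff₀ hδ] at hk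
  rwa [max_eq_left (by linarith)] at h1

variable {Δ : ℝ≥0} {n m : ℕ}

/-! ### Peano's theorem for delay equations -/

/-- The history segment `x_t` of a function on the whole line. -/
def segment (x : C(ℝ, Euc n)) (t : ℝ) : History Δ n :=
  x.comp ⟨fun θ : Icc (-(Δ : ℝ)) 0 => t + θ, by fun_prop⟩

@[simp]
lemma segment_apply (x : C(ℝ, Euc n)) (t : ℝ) (θ : Icc (-(Δ : ℝ)) 0) :
    segment x t θ = x (t + θ) := rfl

lemma continuous_segment :
    Continuous fun p : C(ℝ, Euc n) × ℝ => (segment p.1 p.2 : History Δ n) := by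
  refine continuous_fst.compCM (ContinuousMap.continuous_of_continuous_uncurry _ ?_)
  change Continuous fun q : (C(ℝ, Euc n) × ℝ) × Icc (-(Δ : ℝ)) 0 => q.1.2 + (q.2 : ℝ)
  fun_prop

lemma continuous_segment_right (x : C(ℝ, Euc n)) :
    Continuous fun t => (segment x t : History Δ n) :=
  continuous_segment.comp (by fun_prop : Continuous fun t : ℝ => (x, t))

lemma segment_congr {x y : C(ℝ, Euc n)} {t : ℝ} (h : ∀ s ≤ t, x s = y s) :
    (segment x t : History Δ n) = segment y t := by
  ext1 θ
  exact h (t + θ) (by linarith [θ.2.2])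

section Peano

variable (F : C(History Δ n, Euc n)) (p : C(ℝ, Euc n)) (b : ℝ)

lemma continuous_comp_segment (x : C(ℝ, Euc n)) (h : ℝ) :
    Continuous fun s => F (segment x (s - h)) :=
  F.continuous.comp ((continuous_segment_right x).comp (by fun_prop))

/-- The integral operator of `ẋ(t) = F(x_{t-h})` with past `p` on `(-∞, b]`. -/
noncomputable def delayedPicard (h : ℝ) (x : C(ℝ, Euc n)) : C(ℝ, Euc n) where
  toFun t := p (min t b) + ∫ s in b..max t b, F (segment x (s - h))
  continuous_toFun := by
    have h1 : Continuous fun u => ∫ s in b..u, F (segment x (s - h)) :=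
      intervalIntegral.continuous_primitive
        (fun _ _ => (continuous_comp_segment F x h).intervalIntegrable _ _) b
    exact (p.continuous.comp (by fun_prop)).add (h1.comp (by fun_prop))

lemma delayedPicard_apply (h : ℝ) (x : C(ℝ, Euc n)) (t : ℝ) :
    delayedPicard F p b h x t = p (min t b) + ∫ s in b..max t b, F (segment x (s - h)) := rfl

lemma delayedPicard_congr {h T : ℝ} {x y : C(ℝ, Euc n)} (hbT : b ≤ T)
    (hxy : ∀ s ≤ T - h, x s = y s) :
    ∀ t ≤ T, delayedPicard F p b h x t = delayedPicard F p b h y t := by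
  intro t ht
  rw [delayedPicard_apply, delayedPicard_apply]
  congr 1
  refine intervalIntegral.integral_congr fun s hs => ?_
  rw [uIcc_of_le (le_max_right _ _)] at hs
  have hsT : s ≤ T := hs.2.trans (max_le ht hbT)
  rw [segment_congr fun r hr => hxy r (by linarith)]

/-- Each application of the delayed operator determines the solution on a further interval of
length `h`. -/
lemma delayedPicard_iterate_succ {h : ℝ} (hh : 0 ≤ h) (j : ℕ) :
    ∀ t ≤ b + j * h,
      (delayedPicard F p b h)^[j + 1] p t = (delayedPicard F p b h)^[j] p t := by
  induction j with
  | zero =>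
    intro t ht
    simp only [Nat.cast_zero, zero_mul, add_zero] at ht
    simp [delayedPicard_apply, ht]
  | succ j ih =>
    intro t ht
    push_cast at ht
    rw [Function.iterate_succ_apply']
    nth_rewrite 2 [Function.iterate_succ_apply']
    exact delayedPicard_congr F p b (T := b + (j + 1) * h)
      (le_add_of_nonneg_right (by positivity)) (fun s hs => ih s (by linarith)) t ht

/-- Tonelli's approximate solutions: for every `k`, the equation with the retarded argument
`s - 1/(k+1)` has a solution up to time `b + k`. -/
lemma exists_delayed_solution (k : ℕ) : ∃ x y : C(ℝ, Euc n),
    x = delayedPicard F p b (1 / ((k : ℝ) + 1)) y ∧ ∀ t ≤ b + k,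
      x t = delayedPicard F p b (1 / ((k : ℝ) + 1)) x t := by
  have hh : (0 : ℝ) < 1 / ((k : ℝ) + 1) := by positivity
  set h : ℝ := 1 / ((k : ℝ) + 1) with hh_def
  refine ⟨(delayedPicard F p b h)^[k * (k + 1) + 1] p, (delayedPicard F p b h)^[k * (k + 1)] p,
    Function.iterate_succ_apply' _ _ _, fun t ht => ?_⟩
  have hk : ((k * (k + 1) : ℕ) : ℝ) * h = k := by
    rw [hh_def]; push_cast; field_simp
  nth_rewrite 1 [Function.iterate_succ_apply']
  refine delayedPicard_congr F p b (le_add_of_nonneg_right k.cast_nonneg) (fun s hs => ?_) t ht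
  exact (delayedPicard_iterate_succ F p b hh.le _ s (by rw [hk]; linarith)).symm

variable {F} {M : ℝ}

lemma norm_delayedPicard_sub_le (hM : ∀ φ, ‖F φ‖ ≤ M) (h : ℝ) (x : C(ℝ, Euc n)) (s t : ℝ) :
    ‖delayedPicard F p b h x t - delayedPicard F p b h x s‖ ≤
      ‖p (min t b) - p (min s b)‖ + M * |max t b - max s b| := by
  have hint : ∀ u v, IntervalIntegrable (fun s => F (segment x (s - h))) MeasureTheory.volume u v :=
    fun _ _ => (continuous_comp_segment F x h).intervalIntegrable _ _
  rw [delayedPicard_apply, delayedPicard_apply, add_sub_add_comm,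
    intervalIntegral.integral_interval_sub_left (hint _ _) (hint _ _)]
  exact (norm_add_le _ _).trans (add_le_add le_rfl
    (intervalIntegral.norm_integral_le_of_norm_le_const fun s _ => hM _))

/-- The functions obeying the continuity modulus of the approximate solutions form a compact set
for locally uniform convergence. -/
lemma isCompact_modulus (M : ℝ) : IsCompact {x : C(ℝ, Euc n) | x b = p b ∧ ∀ s t,
    ‖x t - x s‖ ≤ ‖p (min t b) - p (min s b)‖ + M * |max t b - max s b|} := by
  refine ArzelaAscoli.isCompact_of_equicontinuous _ ?_ ?_
  · have hcomp : IsCompact {x : ℝ → Euc n | ∀ t, x t ∈ Metric.closedBall (p b)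
        (‖p (min t b) - p (min b b)‖ + M * |max t b - max b b|)} :=
      isCompact_pi_infinite fun t => isCompact_closedBall _ _
    have hclosed : IsClosed {x : ℝ → Euc n | x b = p b ∧ ∀ s t,
        ‖x t - x s‖ ≤ ‖p (min t b) - p (min s b)‖ + M * |max t b - max s b|} := by
      simp only [Set.ofPred_and, Set.ofPred_forall]
      exact (isClosed_eq (continuous_apply b) continuous_const).inter
        (isClosed_iInter fun s => isClosed_iInter fun t => isClosed_le
          ((continuous_apply t).sub (continuous_apply s)).norm continuous_const)
    convert hcomp.of_isClosed_subset hclosed fun x hx t => ?_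
    · ext x
      constructor
      · rintro ⟨x, hx, rfl⟩
        exact hx
      · intro hx
        refine ⟨⟨x, continuous_iff_continuousAt.2 fun s => ?_⟩, hx, rfl⟩
        have hc : Continuous fun t =>
            ‖p (min t b) - p (min s b)‖ + M * |max t b - max s b| := by fun_prop
        rw [ContinuousAt, tendsto_iff_norm_sub_tendsto_zero]
        exact squeeze_zero (fun _ => norm_nonneg _) (hx.2 s) (by simpa using hc.tendsto s)
    · rw [mem_closedBall_iff_norm, ← hx.1]
      exact hx.2 b t
  · intro t₀
    refine Metric.equicontinuousAt_of_continuity_modulus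
      (fun t => ‖p (min t b) - p (min t₀ b)‖ + M * |max t b - max t₀ b|) ?_ _
      (Eventually.of_forall fun t x => ?_)
    · have : Continuous fun t => ‖p (min t b) - p (min t₀ b)‖ + M * |max t b - max t₀ b| := by
        fun_prop
      simpa using this.tendsto t₀
    · rw [dist_eq_norm_sub']
      exact x.2.2 t₀ t

/-- Peano's theorem with a prescribed past, for bounded continuous right-hand sides. -/
theorem exists_integral_solution (hM : ∀ φ, ‖F φ‖ ≤ M) : ∃ z : C(ℝ, Euc n),
    (∀ t ≤ b, z t = p t) ∧ ∀ t, b ≤ t → z t = p b + ∫ s in b..t, F (segment z s) := by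
  choose x y hxy hx using exists_delayed_solution F p b
  have hmem : ∀ k, x k ∈ {x : C(ℝ, Euc n) | x b = p b ∧ ∀ s t,
      ‖x t - x s‖ ≤ ‖p (min t b) - p (min s b)‖ + M * |max t b - max s b|} := by
    intro k
    rw [hxy]
    exact ⟨by simp [delayedPicard_apply], norm_delayedPicard_sub_le p b hM _ _⟩
  obtain ⟨z, -, φ, hφ, hlim⟩ := (isCompact_modulus p b M).tendsto_subseq hmem
  have hpt : ∀ t, Tendsto (fun k => x (φ k) t) atTop (𝓝 (z t)) := fun t =>
    ((continuous_eval_const t).tendsto z).comp hlim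
  have hh : Tendsto (fun k => 1 / ((φ k : ℝ) + 1)) atTop (𝓝 0) :=
    tendsto_one_div_add_atTop_nhds_zero_nat.comp hφ.tendsto_atTop
  have hlimit : ∀ t, z t = p (min t b) + ∫ s in b..max t b, F (segment z s) := by
    intro t
    refine tendsto_nhds_unique (hpt t) ?_
    have hconv : Tendsto (fun k => p (min t b) + ∫ s in b..max t b,
        F (segment (x (φ k)) (s - 1 / ((φ k : ℝ) + 1)))) atTop
        (𝓝 (p (min t b) + ∫ s in b..max t b, F (segment z s))) := by
      refine tendsto_const_nhds.add
        (intervalIntegral.tendsto_integral_filter_of_dominated_convergence (fun _ => M)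
          (Eventually.of_forall fun k => (continuous_comp_segment F _ _).aestronglyMeasurable)
          (Eventually.of_forall fun k => Eventually.of_forall fun s _ => hM _)
          intervalIntegrable_const (Eventually.of_forall fun s _ => ?_))
      have h1 : Tendsto (fun k => (x (φ k), s - 1 / ((φ k : ℝ) + 1))) atTop (𝓝 (z, s)) := by
        have := hlim.prodMk_nhds (tendsto_const_nhds.sub hh : Tendsto (fun k =>
          s - 1 / ((φ k : ℝ) + 1)) atTop (𝓝 (s - 0)))
        simpa using this
      exact ((F.continuous.comp continuous_segment).tendsto (z, s)).comp h1
    refine hconv.congr' ?_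
    filter_upwards [(tendsto_natCast_atTop_atTop.comp hφ.tendsto_atTop).eventually_ge_atTop
      (t - b)] with k hk
    rw [Function.comp_apply] at hk
    rw [hx (φ k) t (by linarith), delayedPicard_apply]
  refine ⟨z, fun t ht => ?_, fun t ht => ?_⟩
  · rw [hlimit, min_eq_left ht, max_eq_right ht]; simp
  · rw [hlimit, min_eq_right ht, max_eq_left ht]

end Peano

/-! ### The Sontag-type feedback -/

section Kappa

variable {lam : ℝ}

/-- For `p < 0` the rationalized form of `κ` has no singularity at `q = 0`. -/
lemma kappa_eq_of_neg {p : ℝ} (hlam : 0 < lam) (hp : p < 0) (q : Euc m) :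
    kappa lam p q = (-(lam * ‖q‖ ^ 2 / (Real.sqrt (p ^ 2 + lam * ‖q‖ ^ 4) - p))) • q := by
  by_cases hq : q = 0
  · simp [kappa, hq]
  · rw [kappa, if_neg hq]
    have hq' : ‖q‖ ≠ 0 := norm_ne_zero_iff.2 hq
    have hs : Real.sqrt (p ^ 2 + lam * ‖q‖ ^ 4) ^ 2 = p ^ 2 + lam * ‖q‖ ^ 4 :=
      Real.sq_sqrt (by positivity)
    have hpos : Real.sqrt (p ^ 2 + lam * ‖q‖ ^ 4) - p ≠ 0 := by
      have := Real.sqrt_nonneg (p ^ 2 + lam * ‖q‖ ^ 4)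
      linarith
    congr 1
    field_simp
    linear_combination -hs

lemma continuousAt_kappa (hlam : 0 < lam) {p : ℝ} {q : Euc m} (h : q = 0 → p < 0) :
    ContinuousAt (fun z : ℝ × Euc m => kappa lam z.1 z.2) (p, q) := by
  by_cases hq : q = 0
  · have hp := h hq
    have hne : Real.sqrt (p ^ 2 + lam * ‖q‖ ^ 4) - p ≠ 0 := by
      have := Real.sqrt_nonneg (p ^ 2 + lam * ‖q‖ ^ 4)
      linarith
    have hc : ContinuousAt (fun z : ℝ × Euc m =>
        (-(lam * ‖z.2‖ ^ 2 / (Real.sqrt (z.1 ^ 2 + lam * ‖z.2‖ ^ 4) - z.1))) • z.2) (p, q) := by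
      refine ContinuousAt.fun_smul (ContinuousAt.fun_neg (ContinuousAt.div ?_ ?_ hne))
        continuousAt_snd
      · fun_prop
      · exact Continuous.continuousAt (by fun_prop)
    refine hc.congr ?_
    filter_upwards [continuousAt_fst.eventually (gt_mem_nhds hp)] with z hz
    exact (kappa_eq_of_neg hlam hz _).symm
  · have hc : ContinuousAt (fun z : ℝ × Euc m =>
        ((z.1 + Real.sqrt (z.1 ^ 2 + lam * ‖z.2‖ ^ 4)) / (-‖z.2‖ ^ 2)) • z.2) (p, q) := by
      refine ContinuousAt.fun_smul (ContinuousAt.div ?_ ?_ ?_) continuousAt_snd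
      · exact Continuous.continuousAt (by fun_prop)
      · exact Continuous.continuousAt (by fun_prop)
      · simpa using hq
    refine hc.congr ?_
    filter_upwards [continuousAt_snd.eventually_ne hq] with z hz
    rw [kappa, if_neg hz]

/-- The feedback is small when `ε` and `q` are. The hypothesis `p ≤ |q| ε` holds when some `u` with
`|u| ≤ ε` achieves `p + ⟪q, u⟫ ≤ 0`. -/
lemma norm_kappa_le (hlam : 0 < lam) {p ε : ℝ} (hε : 0 ≤ ε) {q : Euc m} (h : p ≤ ‖q‖ * ε) :
    ‖kappa lam p q‖ ≤ 2 * ε + Real.sqrt lam * ‖q‖ := by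
  by_cases hq : q = 0
  · simp [kappa, hq, hε]
  · have hq' : 0 < ‖q‖ := norm_pos_iff.2 hq
    have hsq : Real.sqrt (p ^ 2 + lam * ‖q‖ ^ 4) ≤ |p| + Real.sqrt lam * ‖q‖ ^ 2 := by
      refine Real.sqrt_le_iff.2 ⟨by positivity, ?_⟩
      have h1 := Real.sq_sqrt hlam.le
      have h2 : 0 ≤ |p| * (Real.sqrt lam * ‖q‖ ^ 2) := by positivity
      nlinarith [sq_abs p]
    have hge : |p| ≤ Real.sqrt (p ^ 2 + lam * ‖q‖ ^ 4) :=
      Real.abs_le_sqrt (by nlinarith [show 0 ≤ lam * ‖q‖ ^ 4 by positivity])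
    have hnum : 0 ≤ p + Real.sqrt (p ^ 2 + lam * ‖q‖ ^ 4) := by linarith [neg_abs_le p]
    rw [kappa, if_neg hq, norm_smul, norm_div, norm_neg, Real.norm_of_nonneg hnum,
      Real.norm_of_nonneg (by positivity), div_mul_eq_mul_div, div_le_iff₀ (by positivity)]
    have hup : p + |p| ≤ 2 * ε * ‖q‖ := by
      rcases le_total 0 p with hp | hp
      · rw [abs_of_nonneg hp]; linarith
      · rw [abs_of_nonpos hp]; nlinarith
    nlinarith

/-- The defining property of the feedback: it makes `p + ⟪q, κ⟫` nonpositive. -/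
lemma add_inner_kappa_nonpos {p : ℝ} {q : Euc m} (h : q = 0 → p < 0) :
    p + inner ℝ q (kappa lam p q) ≤ 0 := by
  by_cases hq : q = 0
  · simpa [hq] using (h hq).le
  · rw [kappa, if_neg hq, inner_smul_right, real_inner_self_eq_norm_sq]
    have hq' : ‖q‖ ≠ 0 := norm_ne_zero_iff.2 hq
    have : (p + Real.sqrt (p ^ 2 + lam * ‖q‖ ^ 4)) / (-‖q‖ ^ 2) * ‖q‖ ^ 2 =
        -(p + Real.sqrt (p ^ 2 + lam * ‖q‖ ^ 4)) := by
      field_simp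
    rw [this]
    linarith [Real.sqrt_nonneg (p ^ 2 + lam * ‖q‖ ^ 4)]

end Kappa

lemma continuous_now : Continuous (History.now : History Δ n → Euc n) :=
  continuous_eval_const _

lemma supV_eq_norm {V : Euc n → ℝ} (hV : Continuous V) (φ : History Δ n) :
    supV V φ = ‖(⟨V, hV⟩ : C(Euc n, ℝ)).comp φ‖ := by
  rw [ContinuousMap.norm_eq_iSup_norm]
  rfl

lemma continuous_supV {V : Euc n → ℝ} (hV : Continuous V) :
    Continuous (supV V : History Δ n → ℝ) := by
  rw [funext (supV_eq_norm hV)]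
  exact (ContinuousMap.continuous_postcomp _).norm

lemma supV_nonneg (V : Euc n → ℝ) (φ : History Δ n) : 0 ≤ supV V φ :=
  Real.iSup_nonneg fun _ => abs_nonneg _

lemma inner_lieGT (V : Euc n → ℝ) (g : History Δ n → (Euc m →L[ℝ] Euc n)) (φ : History Δ n)
    (u : Euc m) : inner ℝ (lieGT V g φ) u = lieG V g φ u := by
  rw [lieGT, InnerProductSpace.toDual_symm_apply]

namespace IsCLRFII

variable {U : Set (Euc m)} {f : History Δ n → Euc n} {g : History Δ n → (Euc m →L[ℝ] Euc n)}
  {V : Euc n → ℝ} {γ η : ℝ → ℝ}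

lemma continuous (hV : IsCLRFII U f g V γ η) : Continuous V := hV.contDiff.continuous

lemma map_zero (hV : IsCLRFII U f g V γ η) : V 0 = 0 := by
  obtain ⟨α₁, α₂, h₁, h₂, h⟩ := hV.sandwich
  refine le_antisymm ?_ (hV.nonneg 0)
  simpa [h₂.isClassK.map_zero] using (h 0).2

lemma fderiv_zero (hV : IsCLRFII U f g V γ η) : fderiv ℝ V 0 = 0 :=
  IsLocalMin.fderiv_eq_zero (Eventually.of_forall fun x => by
    rw [hV.map_zero]; exact hV.nonneg x)

lemma continuous_fderiv_now (hV : IsCLRFII U f g V γ η) :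
    Continuous fun φ : History Δ n => fderiv ℝ V φ.now :=
  (hV.contDiff.continuous_fderiv one_ne_zero).comp continuous_now

lemma continuous_drift (hV : IsCLRFII U f g V γ η) (hf : Continuous f) :
    Continuous (drift f V γ η) := by
  have h1 : Continuous fun φ : History Δ n => γ (V φ.now) :=
    hV.classK_γ.continuousOn.comp_continuous (hV.continuous.comp continuous_now)
      fun _ => hV.nonneg _
  have h2 : Continuous fun φ : History Δ n => η (supV V φ) :=
    hV.classK_η.continuousOn.comp_continuous (continuous_supV hV.continuous)
      fun φ => supV_nonneg V φ
  exact ((hV.continuous_fderiv_now.clm_apply hf).add h1).sub h2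

lemma continuous_lieGT (hV : IsCLRFII U f g V γ η) (hg : Continuous g) :
    Continuous (lieGT V g) :=
  (LinearIsometryEquiv.continuous _).comp (hV.continuous_fderiv_now.clm_comp hg)

/-- Where `L_g V` vanishes the control has no effect, so the decrease condition concerns the
drift alone. -/
lemma drift_neg (hV : IsCLRFII U f g V γ η) {φ : History Δ n} (hφ : φ ≠ 0)
    (hq : lieGT V g φ = 0) : drift f V γ η φ < 0 := by
  have h := hV.decrease φ hφ
  simp only [iInf_lt_iff] at h
  obtain ⟨u, -, hu⟩ := h
  rw [EReal.coe_lt_coe_iff, ← inner_lieGT, hq, inner_zero_left] at hu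
  rw [drift]
  linarith

/-- Along the closed loop, `V` obeys the differential inequality of a Lyapunov-Razumikhin
function. -/
lemma fderiv_closedLoop_le (hV : IsCLRFII U f g V γ η) (lam : ℝ) (φ : History Δ n) :
    fderiv ℝ V φ.now (closedLoop f g (sontagFeedback f g V γ η lam) φ) ≤
      -γ (V φ.now) + η (supV V φ) := by
  by_cases hφ : φ = 0
  · have hnow : φ.now = 0 := by rw [hφ]; rfl
    rw [hnow, hV.fderiv_zero, hV.map_zero, hV.classK_γ.map_zero]
    simpa using hV.classK_η.nonneg (supV_nonneg V φ)
  · have h := add_inner_kappa_nonpos (lam := lam) (hV.drift_neg hφ)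
    rw [inner_lieGT, lieG, ContinuousLinearMap.comp_apply, drift, lieF] at h
    rw [closedLoop, sontagFeedback, if_neg hφ, map_add, drift, lieF]
    linarith

theorem continuous_sontagFeedback (hV : IsCLRFII U f g V γ η) (hf : Continuous f)
    (hg : Continuous g) (hscp : RSCP f g V γ η) {lam : ℝ} (hlam : 0 < lam) :
    Continuous (sontagFeedback f g V γ η lam) := by
  rw [continuous_iff_continuousAt]
  intro φ
  have ha := hV.continuous_drift hf
  have hq := hV.continuous_lieGT hg
  by_cases hφ : φ = 0
  · subst hφ
    have hq0 : lieGT V g (0 : History Δ n) = 0 := by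
      have : fderiv ℝ V (0 : History Δ n).now = 0 := hV.fderiv_zero
      rw [lieGT, lieG, this, ContinuousLinearMap.zero_comp, _root_.map_zero]
    rw [Metric.continuousAt_iff]
    intro ε hε
    obtain ⟨δ, hδ, hu⟩ := hscp (ε / 4) (by positivity)
    have hsmall : ∀ᶠ ψ : History Δ n in 𝓝 0, Real.sqrt lam * ‖lieGT V g ψ‖ < ε / 2 := by
      have hc : Continuous fun ψ : History Δ n => Real.sqrt lam * ‖lieGT V g ψ‖ := by fun_prop
      refine hc.continuousAt.eventually (gt_mem_nhds ?_)
      simpa [hq0] using hε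
    obtain ⟨δ', hδ', hsmall⟩ := Metric.eventually_nhds_iff.1 hsmall
    refine ⟨min δ δ', lt_min hδ hδ', fun {ψ} hψ => ?_⟩
    have hk0 : sontagFeedback f g V γ η lam 0 = 0 := by simp [sontagFeedback]
    rw [hk0, dist_zero_right]
    by_cases hψ0 : ψ = 0
    · simpa [hψ0, hk0] using hε
    · obtain ⟨u, huε, hu⟩ := hu ψ hψ0 fun θ => by
        rw [mem_ball_zero_iff]
        rw [dist_zero_right] at hψ
        exact (ψ.norm_coe_le_norm θ).trans_lt (hψ.trans_le (min_le_left _ _))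
      rw [mem_ball_zero_iff] at huε
      have hp : drift f V γ η ψ ≤ ‖lieGT V g ψ‖ * (ε / 4) := by
        have h1 := real_inner_le_norm (lieGT V g ψ) (-u)
        rw [inner_neg_right, inner_lieGT, norm_neg] at h1
        have h2 := mul_le_mul_of_nonneg_left huε.le (norm_nonneg (lieGT V g ψ))
        rw [drift]
        linarith
      have h3 := norm_kappa_le hlam (by positivity) hp
      have h4 := hsmall (hψ.trans_le (min_le_right _ _))
      rw [sontagFeedback, if_neg hψ0]
      linarith
  · have hc : ContinuousAt (fun ψ => kappa lam (drift f V γ η ψ) (lieGT V g ψ)) φ :=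
      (continuousAt_kappa hlam (hV.drift_neg hφ)).comp (f := fun ψ =>
        (drift f V γ η ψ, lieGT V g ψ)) (ha.prodMk hq).continuousAt
    refine hc.congr ?_
    filter_upwards [isOpen_ne.mem_nhds hφ] with ψ hψ
    rw [sontagFeedback, if_neg hψ]

end IsCLRFII

/-! ### Global asymptotic stability -/

lemma History.norm_le {φ : History Δ n} {x : ℝ → Euc n} {t R : ℝ} (hR : 0 ≤ R)
    (hφ : ∀ θ : Icc (-(Δ : ℝ)) 0, φ θ = x (t + θ)) (hx : ∀ s ∈ Icc (t - Δ) t, ‖x s‖ ≤ R) :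
    ‖φ‖ ≤ R := by
  rw [ContinuousMap.norm_le _ hR]
  intro θ
  rw [hφ]
  exact hx _ ⟨by linarith [θ.2.1], by linarith [θ.2.2]⟩

lemma IsSolution.norm_le_of_nonpos {F : History Δ n → Euc n} {ξ : History Δ n} {T : EReal}
    {x : ℝ → Euc n} (hx : IsSolution F ξ T x) {s : ℝ} (hs : s ∈ Icc (-(Δ : ℝ)) 0) :
    ‖x s‖ ≤ ‖ξ‖ := by
  rw [hx.initial ⟨s, hs⟩]
  exact ξ.norm_coe_le_norm _

lemma IsSolution.razumikhinDecay {F : History Δ n → Euc n} {V : Euc n → ℝ} {γ η : ℝ → ℝ}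
    (hV : ContDiff ℝ 1 V) (hV0 : ∀ x, 0 ≤ V x) (hη : IsClassK η)
    (hF : ∀ φ : History Δ n, fderiv ℝ V φ.now (F φ) ≤ -γ (V φ.now) + η (supV V φ))
    {ξ : History Δ n} {T : EReal} {x : ℝ → Euc n} (hx : IsSolution F ξ T x) {b : ℝ}
    (hb : (b : EReal) < T) : RazumikhinDecay γ η Δ b (V ∘ x) where
  continuousOn := hV.continuous.comp_continuousOn (hx.continuousOn.mono fun _ hs =>
    ⟨hs.1, (EReal.coe_le_coe_iff.2 hs.2).trans_lt hb⟩)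
  nonneg t := hV0 _
  decay t ht := by
    obtain ⟨φ, hφ, hder⟩ := hx.equation t ht.1 ((EReal.coe_le_coe_iff.2 ht.2).trans_lt hb)
    have hnow : φ.now = x t := by
      rw [History.now, hφ]
      simp
    refine ⟨fderiv ℝ V (x t) (F φ),
      ((hV.differentiable one_ne_zero) (x t)).hasFDerivAt.comp_hasDerivAt t hder, fun c hc => ?_⟩
    have hsup : supV V φ ≤ c := by
      have : Nonempty (Icc (-(Δ : ℝ)) 0) := ⟨⟨0, by simp⟩⟩
      refine ciSup_le fun θ => ?_
      rw [abs_of_nonneg (hV0 _), hφ]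
      exact hc _ ⟨by linarith [θ.2.1], by linarith [θ.2.2]⟩
    have h1 := hF φ
    have h2 := hη.strictMonoOn.monotoneOn (supV_nonneg V φ) ((supV_nonneg V φ).trans hsup) hsup
    rw [hnow] at h1
    exact h1.trans (add_le_add le_rfl h2)

/-- The Razumikhin theorem with a class `K` gap `γ - η`. -/
theorem isGAS_of_razumikhin {F : History Δ n → Euc n} {V : Euc n → ℝ} {γ η α₁ α₂ : ℝ → ℝ}
    (hV : ContDiff ℝ 1 V) (hV0 : ∀ x, 0 ≤ V x) (h₁ : IsClassKInfty α₁) (h₂ : IsClassK α₂)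
    (hα : ∀ x, α₁ ‖x‖ ≤ V x ∧ V x ≤ α₂ ‖x‖) (hγ : IsClassK γ) (hη : IsClassK η)
    (hsub : IsClassK fun s => γ s - η s)
    (hF : ∀ φ : History Δ n, fderiv ℝ V φ.now (F φ) ≤ -γ (V φ.now) + η (supV V φ)) :
    IsGAS F := by
  have hm₂ : ∀ {r s}, 0 ≤ r → r ≤ s → α₂ r ≤ α₂ s := fun hr hrs =>
    h₂.strictMonoOn.monotoneOn hr (hr.trans hrs) hrs
  -- Sublevel sets of `V` lie in balls, by monotonicity of `α₁`.
  have hV_le : ∀ {x : Euc n} {s}, 0 ≤ s → V x ≤ α₁ s → ‖x‖ ≤ s := fun hs h =>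
    (h₁.isClassK.strictMonoOn.le_iff_le (norm_nonneg _) hs).1 ((hα _).1.trans h)
  have hinit : ∀ {ξ : History Δ n} {T x R}, IsSolution F ξ T x → ‖ξ‖ ≤ R →
      ∀ s ∈ Icc (-(Δ : ℝ)) 0, (V ∘ x) s ≤ α₂ R := by
    intro ξ T x R hx hR s hs
    exact (hα _).2.trans (hm₂ (norm_nonneg _) ((hx.norm_le_of_nonpos hs).trans hR))
  have hstable : ∀ {ξ : History Δ n} {T x R} {t : ℝ}, IsSolution F ξ T x → ‖ξ‖ ≤ R → 0 ≤ t →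
      (t : EReal) < T → V (x t) ≤ α₂ R := by
    intro ξ T x R t hx hR ht htT
    exact (hx.razumikhinDecay hV hV0 hη hF htT).le_of_le hsub Δ.2 (hinit hx hR) t
      ⟨by linarith [Δ.2], le_rfl⟩
  suffices h : ∃ β, IsClassKL β ∧ ∀ r t y : ℝ, (∃ (ξ : History Δ n) (T : EReal) (x : ℝ → Euc n),
      IsSolution F ξ T x ∧ 0 ≤ t ∧ (t : EReal) < T ∧ r = ‖ξ‖ ∧ y = ‖x t‖) → y ≤ β r t by
    obtain ⟨β, hβ, hS⟩ := h
    exact ⟨β, hβ, fun ξ T x hx t ht htT => hS _ _ _ ⟨ξ, T, x, hx, ht, htT, rfl, rfl⟩⟩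
  apply exists_classKL_bound
  · rintro r t y ⟨ξ, T, x, hx, ht, htT, rfl, rfl⟩
    exact norm_nonneg _
  · intro R
    obtain ⟨s, hs, hle⟩ := h₁.unbounded (α₂ R)
    refine ⟨s, ?_⟩
    rintro r t y ⟨ξ, T, x, hx, ht, htT, rfl, rfl⟩ hr
    exact hV_le hs ((hstable hx hr ht htT).trans hle)
  · intro ε hε
    have hc : ContinuousWithinAt α₂ (Ici 0) 0 := h₂.continuousOn 0 self_mem_Ici
    obtain ⟨δ, hδ, hδα⟩ := Metric.continuousWithinAt_iff.1 hc (α₁ ε) (h₁.isClassK.pos hε)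
    have hlt := hδα (x := δ / 2) (show (0 : ℝ) ≤ δ / 2 by positivity)
      (by rw [Real.dist_eq, sub_zero, abs_of_pos (by positivity)]; linarith)
    rw [h₂.map_zero, Real.dist_eq, sub_zero] at hlt
    refine ⟨δ / 2, by positivity, ?_⟩
    rintro r t y ⟨ξ, T, x, hx, ht, htT, rfl, rfl⟩ hr
    exact hV_le hε.le ((hstable hx hr ht htT).trans ((le_abs_self _).trans hlt.le))
  · intro R ε hε
    obtain ⟨τ, hτ⟩ := exists_attraction_time Δ.2 hγ hsub (α₂ R) (h₁.isClassK.pos hε)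
    refine ⟨τ, ?_⟩
    rintro r t y ⟨ξ, T, x, hx, ht, htT, rfl, rfl⟩ hr hτt
    exact hV_le hε.le
      (hτ t _ (hx.razumikhinDecay hV hV0 hη hF htT) (hinit hx hr) t ⟨hτt, le_rfl⟩)

/-! ### Local existence and forward completeness -/

/-- The radial truncation of a vector at the norm `c`. -/
noncomputable def clampNorm (c : ℝ) (v : Euc n) : Euc n := (c / max c ‖v‖) • v

lemma continuous_clampNorm {c : ℝ} (hc : 0 < c) : Continuous (clampNorm c : Euc n → Euc n) := by
  refine Continuous.fun_smul (Continuous.div ?_ ?_ fun v => ?_) continuous_id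
  · fun_prop
  · fun_prop
  · exact (hc.trans_le (le_max_left _ _)).ne'

lemma clampNorm_of_le {c : ℝ} (hc : 0 < c) {v : Euc n} (hv : ‖v‖ ≤ c) : clampNorm c v = v := by
  rw [clampNorm, max_eq_left hv, div_self hc.ne', one_smul]

lemma norm_clampNorm_le {c : ℝ} (hc : 0 < c) (v : Euc n) : ‖clampNorm c v‖ ≤ c := by
  have hpos : 0 < max c ‖v‖ := hc.trans_le (le_max_left _ _)
  rw [clampNorm, norm_smul, Real.norm_of_nonneg (by positivity), div_mul_eq_mul_div,
    div_le_iff₀ hpos]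
  exact mul_le_mul_of_nonneg_left (le_max_right _ _) hc.le

/-- The truncation of a continuous right-hand side, as a bounded continuous map. -/
noncomputable def clampField {F : History Δ n → Euc n} (hF : Continuous F) {c : ℝ} (hc : 0 < c) :
    C(History Δ n, Euc n) :=
  ⟨fun φ => clampNorm c (F φ), (continuous_clampNorm hc).comp hF⟩

lemma clampField_of_le {F : History Δ n → Euc n} (hF : Continuous F) {c : ℝ} (hc : 0 < c)
    {φ : History Δ n} (h : ‖F φ‖ ≤ c) : clampField hF hc φ = F φ :=
  clampNorm_of_le hc h

lemma hasDerivAt_of_integral_eq {G : C(History Δ n, Euc n)} {z : C(ℝ, Euc n)} {a : ℝ} {v : Euc n}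
    (h : ∀ t, a < t → z t = v + ∫ s in a..t, G (segment z s)) {t : ℝ} (ht : a < t) :
    HasDerivAt z (G (segment z t)) t := by
  have hc : Continuous fun s => G (segment z s) :=
    G.continuous.comp (continuous_segment_right z)
  refine ((intervalIntegral.integral_hasDerivAt_right (hc.intervalIntegrable a t)
    hc.aestronglyMeasurable.stronglyMeasurableAtFilter hc.continuousAt).const_add
      v).congr_of_eventuallyEq ?_
  filter_upwards [lt_mem_nhds ht] with s hs using h s hs

lemma isSolution_of_segment {F : History Δ n → Euc n} {ξ : History Δ n} {T : EReal}
    {z : C(ℝ, Euc n)} (hT : 0 < T) (h0 : ∀ θ : Icc (-(Δ : ℝ)) 0, z θ = ξ θ)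
    (h : ∀ t : ℝ, 0 < t → (t : EReal) < T → HasDerivAt z (F (segment z t)) t) :
    IsSolution F ξ T z :=
  ⟨hT, z.continuous.continuousOn, h0, fun t ht htT => ⟨segment z t, fun _ => rfl, h t ht htT⟩⟩

lemma segment_zero_eq {ξ : History Δ n} {z : C(ℝ, Euc n)}
    (h0 : ∀ θ : Icc (-(Δ : ℝ)) 0, z θ = ξ θ) : segment z 0 = ξ := by
  ext1 θ
  rw [segment_apply, zero_add, h0]

/-- Continuity of the right-hand side suffices for local existence: truncation at a level above
`|F(ξ)|` does not affect a solution for small times. -/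
theorem hasLocalSolutions_of_continuous {F : History Δ n → Euc n} (hF : Continuous F) :
    HasLocalSolutions F := by
  intro ξ
  have hc : 0 < ‖F ξ‖ + 1 := by positivity
  have hΔ : -(Δ : ℝ) ≤ 0 := by simp
  obtain ⟨z, hz0, hz⟩ := exists_integral_solution (F := clampField hF hc)
    ⟨IccExtend hΔ ξ, ξ.continuous.Icc_extend'⟩ 0 (fun φ => norm_clampNorm_le hc _)
  have hinit : ∀ θ : Icc (-(Δ : ℝ)) 0, z θ = ξ θ := fun θ => by
    rw [hz0 θ θ.2.2]
    exact IccExtend_val hΔ ξ θ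
  have hev : ∀ᶠ t in 𝓝 (0 : ℝ), ‖F (segment z t)‖ < ‖F ξ‖ + 1 := by
    refine (hF.comp (continuous_segment_right z)).norm.continuousAt.eventually (gt_mem_nhds ?_)
    simp [segment_zero_eq hinit]
  obtain ⟨τ, hτ, hball⟩ := Metric.eventually_nhds_iff.1 hev
  refine ⟨τ, z, isSolution_of_segment (EReal.coe_pos.2 hτ) hinit fun t ht htτ => ?_⟩
  have := hasDerivAt_of_integral_eq (fun t ht => hz t ht.le) ht
  rwa [clampField_of_le hF hc] at this
  refine (hball ?_).le
  rw [Real.dist_eq, sub_zero, abs_of_pos ht]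
  exact EReal.coe_lt_coe_iff.1 htτ

/-- A solution with bounded derivative on `[-Δ, b)` is the restriction of a continuous function on
the line, since it is Lipschitz on `(0, b)`. -/
lemma IsSolution.exists_continuous_extension {F : History Δ n → Euc n} {ξ : History Δ n} {b M : ℝ}
    {x : ℝ → Euc n} (hx : IsSolution F ξ b x)
    (hM : ∀ t ∈ Ioo 0 b, ∀ v, HasDerivAt x v t → ‖v‖ ≤ M) :
    ∃ p : C(ℝ, Euc n), ∀ t ∈ Ico (-(Δ : ℝ)) b, p t = x t := by
  have hb : 0 < b := EReal.coe_pos.1 hx.pos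
  have hderiv : ∀ t ∈ Ioo 0 b, HasDerivAt x (deriv x t) t := fun t ht => by
    obtain ⟨φ, -, hφ⟩ := hx.equation t ht.1 (EReal.coe_lt_coe_iff.2 ht.2)
    exact hφ.differentiableAt.hasDerivAt
  have hlip : LipschitzOnWith M.toNNReal x (Ioo 0 b) :=
    (convex_Ioo 0 b).lipschitzOnWith_of_nnnorm_hasDerivWithin_le
      (fun t ht => (hderiv t ht).hasDerivWithinAt) fun t ht => by
        rw [← NNReal.coe_le_coe, coe_nnnorm]
        exact (hM t ht _ (hderiv t ht)).trans (Real.le_coe_toNNReal M)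
  obtain ⟨g, hg, hgx⟩ := hlip.extend_finite_dimension
  have hΔ : -(Δ : ℝ) ≤ b / 2 := by
    have := Δ.2
    linarith
  have hcont : Continuous (IccExtend hΔ ((Icc (-(Δ : ℝ)) (b / 2)).domRestrict x)) := by
    refine (continuousOn_iff_continuous_domRestrict.1
      (hx.continuousOn.mono fun t ht => ?_)).Icc_extend'
    exact ⟨ht.1, EReal.coe_lt_coe_iff.2 (by linarith [ht.2])⟩
  have hval : ∀ t ∈ Icc (-(Δ : ℝ)) (b / 2),
      IccExtend hΔ ((Icc (-(Δ : ℝ)) (b / 2)).domRestrict x) t = x t := fun t ht =>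
    IccExtend_of_mem hΔ _ ht
  refine ⟨⟨fun t =>
      if t ≤ b / 2 then IccExtend hΔ ((Icc (-(Δ : ℝ)) (b / 2)).domRestrict x) t else g t,
    hcont.if_le hg.continuous continuous_id continuous_const fun t ht => ?_⟩, fun t ht => ?_⟩
  · have ht : t = b / 2 := ht
    rw [ht, hval _ ⟨hΔ, le_rfl⟩]
    exact hgx ⟨by positivity, by linarith⟩
  · by_cases h : t ≤ b / 2
    · simpa [h] using hval t ⟨ht.1, h⟩
    · simpa [h] using (hgx ⟨by linarith, ht.2⟩).symm

/-- Solutions that stay bounded can be continued when the right-hand side is bounded on bounded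
sets: beyond `b` the equation is solved with a right-hand side truncated above the values that it
takes on the a priori ball, and the a priori bound shows that the truncation is never active. -/
theorem isForwardComplete_of_isGAS {F : History Δ n → Euc n} (hF : Continuous F) (hgas : IsGAS F)
    (hbdd : MapsBoundedToBounded F) : IsForwardComplete F := by
  intro ξ T x hx
  obtain ⟨β, hβ, hβx⟩ := hgas
  obtain ⟨R, hξR, hR⟩ : ∃ R, ‖ξ‖ ≤ R ∧ ∀ (T : EReal) (x : ℝ → Euc n), IsSolution F ξ T x →
      ∀ t : ℝ, -(Δ : ℝ) ≤ t → (t : EReal) < T → ‖x t‖ ≤ R := by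
    refine ⟨max ‖ξ‖ (β ‖ξ‖ 0), le_max_left _ _, fun T x hx t ht htT => ?_⟩
    rcases le_total t 0 with h | h
    · exact (hx.norm_le_of_nonpos ⟨ht, h⟩).trans (le_max_left _ _)
    · exact (hβx ξ T x hx t h htT).trans
        ((hβ.antitoneOn _ (norm_nonneg _) self_mem_Ici h h).trans (le_max_right _ _))
  have hR0 : 0 ≤ R := (norm_nonneg _).trans hξR
  obtain ⟨M, hM⟩ : ∃ M, ∀ φ : History Δ n, ‖φ‖ ≤ R → ‖F φ‖ ≤ M := by
    obtain ⟨M, hM⟩ := (hbdd _ (Metric.isBounded_closedBall (x := 0) (r := R))).exists_norm_le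
    exact ⟨M, fun φ hφ => hM _ ⟨φ, by simpa using hφ, rfl⟩⟩
  have hM0 : 0 ≤ M := (norm_nonneg _).trans (hM ξ hξR)
  induction T with
  | bot => exact absurd hx.pos (by simp)
  | top => exact ⟨x, hx, fun _ _ _ => rfl⟩
  | coe b =>
  have hb : 0 < b := EReal.coe_pos.1 hx.pos
  obtain ⟨p, hp⟩ := hx.exists_continuous_extension (M := M) fun t ht v hv => by
    obtain ⟨φ, hφ, hder⟩ := hx.equation t ht.1 (EReal.coe_lt_coe_iff.2 ht.2)
    rw [hv.unique hder]
    exact hM φ (History.norm_le hR0 hφ fun s hs => hR _ x hx s (by linarith [hs.1, ht.1])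
      (EReal.coe_lt_coe_iff.2 (by linarith [hs.2, ht.2])))
  have hc : 0 < M + 1 := by positivity
  obtain ⟨z, hzp, hz⟩ := exists_integral_solution (F := clampField hF hc) p b
    (fun φ => norm_clampNorm_le hc _)
  have hzx : ∀ t ∈ Ico (-(Δ : ℝ)) b, z t = x t := fun t ht => by rw [hzp t ht.2.le, hp t ht]
  have hinit : ∀ θ : Icc (-(Δ : ℝ)) 0, z θ = ξ θ := fun θ => by
    rw [hzx θ ⟨θ.2.1, θ.2.2.trans_lt hb⟩, hx.initial]
  have hGc : Continuous fun s => clampField hF hc (segment z s) :=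
    (clampField hF hc).continuous.comp (continuous_segment_right z)
  -- On `(0, b)` the truncation is inactive.
  have hbefore : ∀ t ∈ Ioo 0 b, HasDerivAt z (clampField hF hc (segment z t)) t := by
    intro t ht
    obtain ⟨φ, hφ, hder⟩ := hx.equation t ht.1 (EReal.coe_lt_coe_iff.2 ht.2)
    have hseg : segment z t = φ := by
      ext1 θ
      rw [segment_apply, hφ, hzx _ ⟨by linarith [θ.2.1, ht.1], by linarith [θ.2.2, ht.2]⟩]
    have hφM : ‖F φ‖ ≤ M := hM φ (History.norm_le hR0 hφ fun s hs =>
      hR _ x hx s (by linarith [hs.1, ht.1])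
        (EReal.coe_lt_coe_iff.2 (by linarith [hs.2, ht.2])))
    rw [hseg, clampField_of_le hF hc (by linarith)]
    refine hder.congr_of_eventuallyEq ?_
    filter_upwards [Ioo_mem_nhds ht.1 ht.2] with s hs
    exact hzx s ⟨by linarith [hs.1, Δ.2], hs.2⟩
  -- The integral equation from time `0` gives differentiability at the junction `b` as well.
  have hint : ∀ t, 0 < t → z t = z 0 + ∫ s in (0 : ℝ)..t, clampField hF hc (segment z s) := by
    have hle : ∀ t, 0 < t → t ≤ b →
        z t = z 0 + ∫ s in (0 : ℝ)..t, clampField hF hc (segment z s) := by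
      intro t ht htb
      rw [intervalIntegral.integral_eq_sub_of_hasDerivAt_of_le ht.le z.continuous.continuousOn
        (fun s hs => hbefore s ⟨hs.1, hs.2.trans_le htb⟩) (hGc.intervalIntegrable _ _)]
      abel
    intro t ht
    rcases le_total t b with htb | htb
    · exact hle t ht htb
    · rw [hz t htb, ← hzp b le_rfl, hle b hb le_rfl, add_assoc,
        intervalIntegral.integral_add_adjacent_intervals (hGc.intervalIntegrable _ _)
          (hGc.intervalIntegrable _ _)]
  have hsol : ∀ T : EReal, 0 < T → (∀ t : ℝ, 0 < t → (t : EReal) < T →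
      ‖F (segment z t)‖ ≤ M + 1) → IsSolution F ξ T z := fun T hT h =>
    isSolution_of_segment hT hinit fun t ht htT => by
      have := hasDerivAt_of_integral_eq hint ht
      rwa [clampField_of_le hF hc (h t ht htT)] at this
  have hinactive : ∀ t, 0 ≤ t → ‖F (segment z t)‖ < M + 1 := by
    by_contra! hcon
    have hFc : Continuous fun t => ‖F (segment z t)‖ :=
      (hF.comp (continuous_segment_right z)).norm
    have hclosed : IsClosed {t : ℝ | 0 ≤ t ∧ M + 1 ≤ ‖F (segment z t)‖} :=
      (isClosed_le continuous_const continuous_id).inter (isClosed_le continuous_const hFc)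
    have hBB : BddBelow {t : ℝ | 0 ≤ t ∧ M + 1 ≤ ‖F (segment z t)‖} := ⟨0, fun t ht => ht.1⟩
    set t₁ := sInf {t : ℝ | 0 ≤ t ∧ M + 1 ≤ ‖F (segment z t)‖} with ht₁_def
    have ht₁ : 0 ≤ t₁ ∧ M + 1 ≤ ‖F (segment z t₁)‖ := hclosed.csInf_mem hcon hBB
    have hpos : 0 < t₁ := by
      refine ht₁.1.lt_of_ne fun h0 => ?_
      have h1 := ht₁.2
      rw [← h0, segment_zero_eq hinit] at h1
      linarith [hM ξ hξR]
    have hs := hsol t₁ (EReal.coe_pos.2 hpos) fun t ht htt₁ => by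
      by_contra! hlt
      exact absurd (csInf_le hBB ⟨ht.le, hlt.le⟩) (not_le.2 (EReal.coe_lt_coe_iff.1 htt₁))
    have hzR : ∀ s, -(Δ : ℝ) ≤ s → s < t₁ → ‖z s‖ ≤ R := fun s hs1 hs2 =>
      hR _ z hs s hs1 (EReal.coe_lt_coe_iff.2 hs2)
    have hzt₁ : ‖z t₁‖ ≤ R := by
      refine le_of_tendsto (z.continuous.norm.continuousAt.mono_left
        (nhdsWithin_le_nhds (s := Iio t₁))) ?_
      filter_upwards [Ioo_mem_nhdsLT hpos] with s hs'
      exact hzR s (by linarith [hs'.1, Δ.2]) hs'.2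
    have := hM (segment z t₁) (History.norm_le (x := z) (t := t₁) hR0 (fun _ => rfl)
      fun s hs' => by
        rcases hs'.2.lt_or_eq with h | rfl
        · exact hzR s (by linarith [hs'.1]) h
        · exact hzt₁)
    linarith [ht₁.2]
  exact ⟨z, hsol ⊤ (by simp) fun t ht _ => (hinactive t ht.le).le,
    fun t ht htb => hzx t ⟨ht, EReal.coe_lt_coe_iff.1 htb⟩⟩

end DelaySystem

/-! ### The closed loop -/

theorem mainTheorem1 (n m : ℕ) (Δ : ℝ≥0) (hΔ : 0 < Δ)
    (f : DelaySystem.History Δ n → DelaySystem.Euc n)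
    (g : DelaySystem.History Δ n → (DelaySystem.Euc m →L[ℝ] DelaySystem.Euc n))
    (hf : LocallyLipschitz f) (hg : LocallyLipschitz g) (hf0 : f 0 = 0)
    (U : Set (DelaySystem.Euc m))
    (V : DelaySystem.Euc n → ℝ) (γ η : ℝ → ℝ)
    (hV : DelaySystem.IsCLRFII U f g V γ η)
    (hscp : DelaySystem.RSCP f g V γ η)
    (lam : ℝ) (hlam : 0 < lam) :
    Continuous (DelaySystem.sontagFeedback f g V γ η lam) ∧
    DelaySystem.IsGAS
      (DelaySystem.closedLoop f g (DelaySystem.sontagFeedback f g V γ η lam)) ∧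
    DelaySystem.HasLocalSolutions
      (DelaySystem.closedLoop f g (DelaySystem.sontagFeedback f g V γ η lam)) ∧
    (DelaySystem.MapsBoundedToBounded
        (DelaySystem.closedLoop f g (DelaySystem.sontagFeedback f g V γ η lam)) →
      DelaySystem.IsForwardComplete
        (DelaySystem.closedLoop f g (DelaySystem.sontagFeedback f g V γ η lam))) := by
  have hk := hV.continuous_sontagFeedback hf.continuous hg.continuous hscp hlam
  have hF : Continuous (DelaySystem.closedLoop f g
      (DelaySystem.sontagFeedback f g V γ η lam)) :=
    hf.continuous.add (hg.continuous.clm_apply hk)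
  obtain ⟨α₁, α₂, h₁, h₂, hα⟩ := hV.sandwich
  have hgas := DelaySystem.isGAS_of_razumikhin hV.contDiff hV.nonneg h₁ h₂.isClassK hα
    hV.classK_γ hV.classK_η hV.classK_sub (hV.fderiv_closedLoop_le lam)
  exact ⟨hk, hgas, DelaySystem.hasLocalSolutions_of_continuous hF,
    DelaySystem.isForwardComplete_of_isGAS hF hgas⟩
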